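/- Let $n\ge 0$ and let $\mathbb{P}(n)$ be the manifold of positive definite Hermitian $n\times n$ complex matrices, an open subset of the real vector space $\mathbb{H}(n)$ of Hermitian matrices, with which every tangent space of $\mathbb{P}(n)$ is identified. For $\Sigma\in\mathbb{P}(n)$ and $H\in\mathbb{H}(n)$ let $\mathcal{L}_\Sigma(H)$ denote the unique solution $X\in\mathbb{H}(n)$ of $\Sigma X+X\Sigma=H$, and equip $\mathbb{P}(n)$ with the Bures-Wasserstein Riemannian metric $$\mathfrak{g}^{BW}_\Sigma(H,K)=\tfrac12\,\mathrm{Re}\,\mathrm{tr}\big(\mathcal{L}_\Sigma(H)K\big),\qquad H,K\in\mathbb{H}(n).$$ Let $\pi(M)=MM^*$ for complex $n\times n$ matrices $M$; at an invertible $M$, call a matrix $A$ horizontal if $\mathrm{Re}\,\mathrm{tr}(AB^*)=0$ for all $B\in\ker d\pi_M$. Let $\Sigma_1,\Sigma_2\in\mathbb{P}(n)$, let $U=(MM^*)^{-1/2}M$ be the unitary polar factor of $M=\Sigma_2^{1/2}\Sigma_1^{1/2}$, and put $$\gamma(t)=(1-t)\,\Sigma_1^{1/2}+t\,\Sigma_2^{1/2}U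 .$$ Then $\gamma(t)$ is invertible for every $t\in[0,1]$, the vector $\gamma'(0)$ is horizontal at $\gamma(0)$, and $\pi\circ\gamma:[0,1]\to\mathbb{P}(n)$ is a geodesic of $(\mathbb{P}(n),\mathfrak{g}^{BW})$ from $\Sigma_1$ to $\Sigma_2$; that is, $\pi\circ\gamma$ is a smooth curve in $\mathbb{P}(n)$ with $\pi(\gamma(0))=\Sigma_1$, $\pi(\gamma(1))=\Sigma_2$, and its velocity is parallel along it for the Levi-Civita connection of $\mathfrak{g}^{BW}$. -/

import Mathlib

open Set
open scoped ContDiff Matrix ComplexOrder MatrixOrder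

/-! ### Riemannian metrics and geodesics on open subsets of a vector space -/

section Riemannian

variable {E : Type*} [NormedAddCommGroup E] [NormedSpace ℝ E] [FiniteDimensional ℝ E]

/-- A smooth Riemannian metric on an open subset `Ω` of a finite dimensional real vector space `E`.
Every tangent space of `Ω` is identified with `E`.  (The values of `inner` outside `Ω` are
irrelevant.) -/
structure RiemannianMetricOn (Ω : TopologicalSpace.Opens E) where
  inner : E → E →ₗ[ℝ] E →ₗ[ℝ] ℝ
  symm : ∀ p ∈ Ω, ∀ v w, inner p v w = inner p w v
  pos : ∀ p ∈ Ω, ∀ v, v ≠ 0 → 0 < inner p v v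
  smooth : ∀ v w, ContDiffOn ℝ ∞ (fun p => inner p v w) Ω

variable {Ω : TopologicalSpace.Opens E}

/-- The Christoffel symbols of the first kind of the Levi-Civita connection in the linear
coordinates of `E`: for constant vector fields `u`, `v`, `w` this is `g(∇_u v, w)`, given by the
Koszul formula `½ (∂_u g(v,w) + ∂_v g(u,w) - ∂_w g(u,v))`. -/
noncomputable def RiemannianMetricOn.christoffel (g : RiemannianMetricOn Ω) (p u v w : E) : ℝ :=
  (1 / 2) * (fderiv ℝ (fun q => g.inner q v w) p u + fderiv ℝ (fun q => g.inner q u w) p v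
    - fderiv ℝ (fun q => g.inner q u v) p w)

/-- `c` restricted to the interval `I` is a geodesic of `(Ω, g)`: it is a smooth curve in `Ω` and
its velocity is parallel along it, `∇_{c'} c' = 0`.  As `g` is nondegenerate, the latter is tested
against all tangent vectors `w`: `g(c'', w) + g(Γ(c', c'), w) = 0`. -/
structure RiemannianMetricOn.IsGeodesicOn (g : RiemannianMetricOn Ω) (c : ℝ → E) (I : Set ℝ) :
    Prop where
  smooth : ContDiffOn ℝ ∞ c I
  mem : ∀ t ∈ I, c t ∈ Ω
  equation : ∀ t ∈ I, ∀ w : E,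
    g.inner (c t) (derivWithin (derivWithin c I) I t) w
      + g.christoffel (c t) (derivWithin c I t) (derivWithin c I t) w = 0

/-- `c : [0,1] → Ω` is a geodesic of `(Ω, g)` from `p` to `q`. -/
def RiemannianMetricOn.IsGeodesicFromTo (g : RiemannianMetricOn Ω) (c : ℝ → E) (p q : E) : Prop :=
  g.IsGeodesicOn c (Icc 0 1) ∧ c 0 = p ∧ c 1 = q

end Riemannian

/-! ### Matrices -/

/-- Complex `n × n` matrices. -/
abbrev CMat (n : ℕ) : Type := Matrix (Fin n) (Fin n) ℂ

/-! Matrices carry the Frobenius (Euclidean) norm. -/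

attribute [local instance] Matrix.frobeniusNormedAddCommGroup Matrix.frobeniusNormedSpace

/-- The real vector space `ℍ(n)` of Hermitian matrices, with the Frobenius norm. -/
def HermMat (n : ℕ) : Type := ↥(selfAdjoint.submodule ℝ (CMat n))

noncomputable instance HermMat.instNormedAddCommGroup (n : ℕ) : NormedAddCommGroup (HermMat n) :=
  inferInstanceAs (NormedAddCommGroup ↥(selfAdjoint.submodule ℝ (CMat n)))

noncomputable instance HermMat.instNormedSpace (n : ℕ) : NormedSpace ℝ (HermMat n) :=
  inferInstanceAs (NormedSpace ℝ ↥(selfAdjoint.submodule ℝ (CMat n)))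

instance HermMat.instFiniteDimensional (n : ℕ) : FiniteDimensional ℝ (HermMat n) :=
  inferInstanceAs (FiniteDimensional ℝ ↥(selfAdjoint.submodule ℝ (CMat n)))

/-- The inclusion of the Hermitian matrices into all matrices. -/
noncomputable def HermMat.toMat {n : ℕ} : HermMat n →ₗ[ℝ] CMat n :=
  (selfAdjoint.submodule ℝ (CMat n)).subtype

noncomputable instance HermMat.instCoe (n : ℕ) : CoeOut (HermMat n) (CMat n) := ⟨HermMat.toMat⟩

/-- A Hermitian matrix as an element of `ℍ(n)`. -/
def HermMat.mk {n : ℕ} (A : CMat n) (hA : A.IsHermitian) : HermMat n := ⟨A, hA⟩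

@[simp] theorem HermMat.toMat_mk {n : ℕ} (A : CMat n) (hA : A.IsHermitian) :
    ((HermMat.mk A hA : HermMat n) : CMat n) = A := rfl

theorem HermMat.toMat_injective {n : ℕ} : Function.Injective (HermMat.toMat (n := n)) :=
  Subtype.val_injective

@[ext] theorem HermMat.ext {n : ℕ} {X Y : HermMat n} (h : (X : CMat n) = Y) : X = Y :=
  HermMat.toMat_injective h

theorem HermMat.conjTranspose_eq {n : ℕ} (X : HermMat n) : (X : CMat n)ᴴ = X := X.2

theorem HermMat.continuous_toMat {n : ℕ} : Continuous (HermMat.toMat (n := n)) :=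
  LinearMap.continuous_of_finiteDimensional _

/-- The positive semidefinite square root of a positive semidefinite matrix. -/
noncomputable def matSqrt {n : ℕ} (A : CMat n) : CMat n := CFC.sqrt A

/-- The unitary polar factor `U = (M M*)^{-1/2} M` of an invertible matrix `M`, so that
`M = (M M*)^{1/2} U`. -/
noncomputable def polarFactor {n : ℕ} (M : CMat n) : CMat n := (matSqrt (M * Mᴴ))⁻¹ * M

theorem isOpen_posDef (n : ℕ) : IsOpen {S : HermMat n | (S : CMat n).PosDef} := by
  have key : {S : HermMat n | (S : CMat n).PosDef}
      = {S : HermMat n | ∀ x ∈ Metric.sphere (0 : EuclideanSpace ℂ (Fin n)) 1,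
          0 < (star (WithLp.ofLp x) ⬝ᵥ ((S : CMat n) *ᵥ (WithLp.ofLp x))).re} := by
    ext S
    constructor
    · intro hS x hx
      refine hS.re_dotProduct_pos (x := WithLp.ofLp x) ?_
      intro h
      have : x = 0 := by ext i; exact congrFun h i
      simp [this] at hx
    · intro h
      have hH : (S : CMat n).IsHermitian := S.2
      refine Matrix.PosDef.of_dotProduct_mulVec_pos hH fun x hx => ?_
      have hx' : (WithLp.toLp 2 x : EuclideanSpace ℂ (Fin n)) ≠ 0 := by
        intro h0; apply hx; simpa using h0
      have hn : (‖(WithLp.toLp 2 x : EuclideanSpace ℂ (Fin n))‖ : ℝ) ≠ 0 := by simpa using hx'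
      set r : ℝ := ‖(WithLp.toLp 2 x : EuclideanSpace ℂ (Fin n))‖
      have h1 := h ((r : ℂ)⁻¹ • WithLp.toLp 2 x) (by
        have hr : 0 ≤ r := norm_nonneg _
        simp only [mem_sphere_iff_norm, sub_zero, norm_smul, norm_inv, Complex.norm_real,
          Real.norm_eq_abs, abs_of_nonneg hr]
        exact inv_mul_cancel₀ hn)
      have hre : 0 < (star x ⬝ᵥ ((S : CMat n) *ᵥ x)).re := by
        simp only [WithLp.ofLp_smul, star_smul, Matrix.mulVec_smul, smul_dotProduct,
          dotProduct_smul, smul_eq_mul] at h1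
        rw [← Complex.ofReal_inv, RCLike.star_def, Complex.conj_ofReal, Complex.re_ofReal_mul,
          Complex.re_ofReal_mul, ← mul_assoc] at h1
        exact pos_of_mul_pos_right h1 (mul_self_nonneg _)
      rw [Complex.lt_def]
      refine ⟨hre, ?_⟩
      have := hH.im_star_dotProduct_mulVec_self x
      simpa using this.symm
  rw [key, isOpen_iff_mem_nhds]
  intro S hS
  refine (isCompact_sphere _ _).eventually_forall_of_forall_eventually fun x hx => ?_
  have hc : Continuous fun z : HermMat n × EuclideanSpace ℂ (Fin n) =>
      (star (WithLp.ofLp z.2) ⬝ᵥ ((z.1 : CMat n) *ᵥ (WithLp.ofLp z.2))).re := by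
    have h2 : Continuous fun z : HermMat n × EuclideanSpace ℂ (Fin n) => WithLp.ofLp z.2 := by
      fun_prop
    have h3 : Continuous fun z : HermMat n × EuclideanSpace ℂ (Fin n) => (z.1 : CMat n) :=
      HermMat.continuous_toMat.comp continuous_fst
    exact Complex.continuous_re.comp (h2.star.dotProduct (h3.matrix_mulVec h2))
  exact hc.continuousAt.eventually (lt_mem_nhds (hS x hx))

/-- `ℙ(n)`: the positive definite matrices, as an open subset of the Hermitian matrices. -/
def posDefOpens (n : ℕ) : TopologicalSpace.Opens (HermMat n) :=
  ⟨{S | (S : CMat n).PosDef}, isOpen_posDef n⟩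

/-! ### The Bures-Wasserstein metric -/

/-- The Lyapunov map `X ↦ Σ X + X Σ` on Hermitian matrices, as a bilinear map in `(Σ, X)`. -/
noncomputable def lyapunovMap (n : ℕ) : HermMat n →ₗ[ℝ] HermMat n →ₗ[ℝ] HermMat n :=
  LinearMap.mk₂ ℝ
    (fun S X => HermMat.mk ((S : CMat n) * X + X * S) (by
      rw [Matrix.IsHermitian, Matrix.conjTranspose_add, Matrix.conjTranspose_mul, Matrix.conjTranspose_mul,
        S.conjTranspose_eq, X.conjTranspose_eq, add_comm]))
    (fun S T X => by ext1; simp only [HermMat.toMat_mk, map_add]; noncomm_ring)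
    (fun r S X => by ext1; simp)
    (fun S X Y => by ext1; simp only [HermMat.toMat_mk, map_add]; noncomm_ring)
    (fun r S X => by ext1; simp)

/-- The linear map `ℒ_Σ`, the inverse of `X ↦ Σ X + X Σ`; so `ℒ_Σ(H)` is the unique Hermitian
solution `X` of `Σ X + X Σ = H`, see `eq_lyapunovSol_iff`. -/
noncomputable def lyapunovSol {n : ℕ} (S : HermMat n) : HermMat n →L[ℝ] HermMat n :=
  (LinearMap.toContinuousLinearMap (lyapunovMap n S)).inverse

theorem re_trace_mul_mul_pos {n : ℕ} {S X : HermMat n} (hS : (S : CMat n).PosDef) (hX : X ≠ 0) :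
    0 < ((X : CMat n) * S * X).trace.re := by
  have h := hS.posSemidef.conjTranspose_mul_mul_same (X : CMat n)
  rw [X.conjTranspose_eq] at h
  have h0 := (Complex.le_def.1 h.trace_nonneg).1
  have h0' := (Complex.le_def.1 h.trace_nonneg).2
  refine lt_of_le_of_ne h0 fun h1 => hX ?_
  have h2 : (X : CMat n) * S * X = 0 := by
    rw [← h.trace_eq_zero_iff]
    exact Complex.ext h1.symm h0'.symm
  ext1
  refine Matrix.ext_of_mulVec_single fun i => ?_
  by_contra hne
  have hne' : (X : CMat n) *ᵥ Pi.single i 1 ≠ 0 := fun h0 =>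
    hne (by rw [h0, map_zero, Matrix.zero_mulVec])
  have h3 := hS.dotProduct_mulVec_pos hne'
  have h4 : star ((X : CMat n) *ᵥ Pi.single i 1) ⬝ᵥ ((S : CMat n) *ᵥ ((X : CMat n) *ᵥ Pi.single i 1))
      = star (Pi.single i 1 : Fin n → ℂ) ⬝ᵥ (((X : CMat n) * (S : CMat n) * (X : CMat n)) *ᵥ Pi.single i 1) := by
    rw [Matrix.star_mulVec, X.conjTranspose_eq, ← Matrix.dotProduct_mulVec, Matrix.mulVec_mulVec,
      Matrix.mulVec_mulVec, Matrix.mul_assoc]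
  rw [h4, h2, Matrix.zero_mulVec, dotProduct_zero] at h3
  exact lt_irrefl _ h3

theorem lyapunovMap_isInvertible {n : ℕ} {S : HermMat n} (hS : (S : CMat n).PosDef) :
    (LinearMap.toContinuousLinearMap (lyapunovMap n S)).IsInvertible := by
  have hinj : Function.Injective (lyapunovMap n S) := by
    rw [injective_iff_map_eq_zero]
    intro X hX
    by_contra hne
    have h1 := re_trace_mul_mul_pos hS hne
    have h2 : (S : CMat n) * X + X * S = 0 := congrArg HermMat.toMat hX
    have h3 : ((X : CMat n) * ((S : CMat n) * X + X * S)).trace.re = 0 := by rw [h2]; simp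
    rw [mul_add, Matrix.trace_add, Matrix.trace_mul_comm (X : CMat n) (X * S), Complex.add_re,
      ← mul_assoc] at h3
    linarith
  refine ⟨(LinearEquiv.ofInjectiveEndo _ hinj).toContinuousLinearEquiv, ?_⟩
  ext X : 1
  rfl

/-- For positive definite `Σ`, `ℒ_Σ(H)` is the unique solution of the Lyapunov equation. -/
theorem eq_lyapunovSol_iff {n : ℕ} {S : HermMat n} (hS : (S : CMat n).PosDef) (H X : HermMat n) :
    X = lyapunovSol S H ↔ (S : CMat n) * X + X * S = H := by
  obtain ⟨e, he⟩ := lyapunovMap_isInvertible hS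
  rw [lyapunovSol, ← he, ContinuousLinearMap.inverse_equiv]
  have h : (S : CMat n) * X + X * S = (e X : HermMat n) := by
    have := congrArg (fun f : HermMat n →L[ℝ] HermMat n => ((f X : HermMat n) : CMat n)) he
    exact this.symm
  rw [h, HermMat.toMat_injective.eq_iff]
  exact (ContinuousLinearEquiv.eq_symm_apply e)

theorem lyapunovSol_spec {n : ℕ} {S : HermMat n} (hS : (S : CMat n).PosDef) (H : HermMat n) :
    (S : CMat n) * lyapunovSol S H + lyapunovSol S H * S = H :=
  (eq_lyapunovSol_iff hS H _).1 rfl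

/-- The real bilinear form `(H, K) ↦ ½ Re tr(ℒ_Σ(H) K)` on Hermitian matrices. -/
noncomputable def bwInner {n : ℕ} (S : HermMat n) : HermMat n →ₗ[ℝ] HermMat n →ₗ[ℝ] ℝ :=
  LinearMap.mk₂ ℝ (fun H K => (1 / 2) * ((lyapunovSol S H : CMat n) * K).trace.re)
    (fun H H' K => by simp [add_mul]; ring)
    (fun r H K => by simp; ring)
    (fun H K K' => by simp [mul_add])
    (fun r H K => by simp; ring)

/-- The Bures-Wasserstein metric `g_Σ(H, K) = ½ Re tr(ℒ_Σ(H) K)` on `ℙ(n)`. -/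
noncomputable def bwMetric (n : ℕ) : RiemannianMetricOn (posDefOpens n) where
  inner := bwInner
  symm S hS H K := by
    change (1 / 2) * ((lyapunovSol S H : CMat n) * K).trace.re
      = (1 / 2) * ((lyapunovSol S K : CMat n) * H).trace.re
    have hH := lyapunovSol_spec hS H
    have hK := lyapunovSol_spec hS K
    generalize lyapunovSol S H = X at *
    generalize lyapunovSol S K = Y at *
    rw [← hH, ← hK, mul_add, mul_add, Matrix.trace_add, Matrix.trace_add]
    have e1 : ((X : CMat n) * (S * Y)).trace = ((Y : CMat n) * (X * S)).trace := by
      rw [← mul_assoc, Matrix.trace_mul_comm]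
    have e2 : ((X : CMat n) * (Y * S)).trace = ((Y : CMat n) * (S * X)).trace := by
      rw [Matrix.trace_mul_comm, mul_assoc]
    rw [e1, e2, add_comm]
  pos S hS H hH := by
    change 0 < (1 / 2) * ((lyapunovSol S H : CMat n) * H).trace.re
    have h := lyapunovSol_spec hS H
    generalize lyapunovSol S H = X at *
    have hX : X ≠ 0 := by
      rintro rfl
      apply hH
      ext1
      rw [← h]
      simp
    have := re_trace_mul_mul_pos hS hX
    rw [← h, mul_add, Matrix.trace_add, Matrix.trace_mul_comm (X : CMat n) (X * S), Complex.add_re,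
      ← mul_assoc]
    linarith
  smooth H K := by
    have h1 : ContDiffOn ℝ ∞ (fun S : HermMat n => lyapunovSol S H) (posDefOpens n) := by
      intro S hS
      obtain ⟨e, he⟩ := lyapunovMap_isInvertible (S := S) hS
      have h2 : ContDiffAt ℝ ∞ ContinuousLinearMap.inverse
          (LinearMap.toContinuousLinearMap (lyapunovMap n S)) := by
        rw [← he]; exact contDiffAt_map_inverse e
      have h3 : ContDiff ℝ ∞ fun S : HermMat n =>
          LinearMap.toContinuousLinearMap (lyapunovMap n S) :=
        (LinearMap.toContinuousLinearMap
          ((LinearMap.toContinuousLinearMap (E := HermMat n) (F' := HermMat n)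
            (𝕜 := ℝ)).toLinearMap ∘ₗ lyapunovMap n)).contDiff
      have h4 : ContDiffAt ℝ ∞ (fun S : HermMat n => lyapunovSol S) S :=
        ContDiffAt.comp S h2 h3.contDiffAt
      exact (h4.clm_apply contDiffAt_const).contDiffWithinAt
    have h5 : ContDiff ℝ ∞ fun X : HermMat n => (1 / 2) * ((X : CMat n) * K).trace.re := by
      let ℓ : HermMat n →ₗ[ℝ] ℝ :=
        { toFun := fun X => (1 / 2) * ((X : CMat n) * K).trace.re
          map_add' := fun X Y => by simp [add_mul]; ring
          map_smul' := fun r X => by simp; ring }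
      exact (LinearMap.toContinuousLinearMap ℓ).contDiff
    exact h5.comp_contDiffOn h1

/-! ### The map `π : M ↦ M M*` and its horizontal spaces -/

/-- The map `π(M) = M M*`. -/
def gramMap {n : ℕ} (M : CMat n) : HermMat n :=
  HermMat.mk (M * Mᴴ) (Matrix.isHermitian_mul_conjTranspose_self M)

/-- The vertical space `ker dπ_M` of `π` at `M`. -/
noncomputable def verticalSpace {n : ℕ} (M : CMat n) : Submodule ℝ (CMat n) :=
  LinearMap.ker (fderiv ℝ (gramMap (n := n)) M).toLinearMap

/-- The horizontal space of `π` at `M`: the orthogonal complement of the vertical space for the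
Euclidean metric `Re tr(A B*)`. -/
def horizontalSpace {n : ℕ} (M : CMat n) : Set (CMat n) :=
  {A | ∀ B ∈ verticalSpace M, (A * Bᴴ).trace.re = 0}

/-! A straight line `t ↦ N + t A` in the Euclidean space of matrices whose direction `A` is
horizontal for `π` at the invertible matrix `N` stays horizontal, because `A` is horizontal at `N`
exactly when `N* A` is Hermitian, and `(N + t A)* A = N* A + t A* A`.  At every point `N` of the
line which is invertible one can therefore write `A = X N` with `X` Hermitian; there the projected
curve through `S = N N*` has velocity `X S + S X`, whose Lyapunov solution is `X`, and acceleration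
`2 X S X`, which is what the geodesic equation asks for.  The curve `γ` is such a line: its
direction is `(T - 1) Σ₁^{1/2}`, where `T = Σ₂^{1/2} (Σ₂^{1/2} Σ₁ Σ₂^{1/2})^{-1/2} Σ₂^{1/2}`. -/

section Calculus

variable {𝕜 E F G : Type*} [NontriviallyNormedField 𝕜] [NormedAddCommGroup E] [NormedSpace 𝕜 E]
  [NormedAddCommGroup F] [NormedSpace 𝕜 F] [NormedAddCommGroup G] [NormedSpace 𝕜 G]

theorem hasDerivAt_add_smul (x v : E) (t : 𝕜) : HasDerivAt (fun t : 𝕜 => x + t • v) v t := by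
  simpa only [one_smul, id] using ((hasDerivAt_id t).smul_const v).const_add x

theorem hasFDerivAt_inverse_clm_apply [CompleteSpace F] {f : E → F →L[𝕜] G}
    {f' : E →L[𝕜] F →L[𝕜] G} {x : E} (hf : HasFDerivAt f f' x) (hx : (f x).IsInvertible) (y : G) :
    HasFDerivAt (fun z => (f z).inverse y)
      (-(f x).inverse ∘L f'.flip ((f x).inverse y)) x := by
  have hdiff : DifferentiableAt 𝕜 (fun z => (f z).inverse y) x :=
    ((hx.contDiffAt_map_inverse (n := 1)).differentiableAt one_ne_zero |>.comp x
      hf.differentiableAt).clm_apply (differentiableAt_const y)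
  have hinv : ∀ᶠ z in nhds x, (f z).IsInvertible := by
    obtain ⟨e, he⟩ := hx
    exact hf.continuousAt.eventually (he ▸ e.nhds)
  have hconst : HasFDerivAt (fun z => f z ((f z).inverse y)) (0 : E →L[𝕜] G) x :=
    (hasFDerivAt_const y x).congr_of_eventuallyEq (hinv.mono fun z hz => hz.self_apply_inverse y)
  have hprod := (hf.clm_apply hdiff.hasFDerivAt).unique hconst
  convert hdiff.hasFDerivAt using 1
  ext v
  have hv : f x (fderiv 𝕜 (fun z => (f z).inverse y) x v) + f' v ((f x).inverse y) = 0 := by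
    simpa using congrArg (· v) hprod
  simp [← map_neg, ← eq_neg_of_add_eq_zero_left hv, hx.inverse_apply_self]

end Calculus

section MatrixLemmas

theorem isHermitian_mul_inv_iff {m R : Type*} [Fintype m] [DecidableEq m] [CommRing R] [StarRing R]
    {M A : Matrix m m R} (hM : IsUnit M) : (A * M⁻¹).IsHermitian ↔ (Mᴴ * A).IsHermitian := by
  have hdet := (Matrix.isUnit_iff_isUnit_det M).1 hM
  constructor <;> intro h
  · simpa [mul_assoc, Matrix.nonsing_inv_mul _ hdet] using
      Matrix.isHermitian_conjTranspose_mul_mul M h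
  · have hinv : (M⁻¹)ᴴ * Mᴴ = 1 := by
      rw [← Matrix.conjTranspose_mul, Matrix.mul_nonsing_inv _ hdet, Matrix.conjTranspose_one]
    simpa [← mul_assoc, hinv] using Matrix.isHermitian_conjTranspose_mul_mul M⁻¹ h

variable {m 𝕜 : Type*} [RCLike 𝕜]

theorem convex_setOf_posDef : Convex ℝ {A : Matrix m m 𝕜 | A.PosDef} :=
  convex_iff_forall_pos.2 fun _ hA _ hB _ _ ha hb _ =>
    Matrix.PosDef.add (hA.smul ha) (hB.smul hb)

variable [Fintype m]

theorem isUnit_add_smul_sub_one_mul [DecidableEq m] {A T : Matrix m m 𝕜} (hA : IsUnit A)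
    (hT : T.PosDef) {t : ℝ} (ht : t ∈ Icc (0 : ℝ) 1) : IsUnit (A + t • ((T - 1) * A)) := by
  have hpos : ((1 - t) • (1 : Matrix m m 𝕜) + t • T).PosDef :=
    convex_setOf_posDef Matrix.PosDef.one hT (sub_nonneg.2 ht.2) ht.1 (sub_add_cancel 1 t)
  convert hpos.isUnit.mul hA using 1
  simp only [add_mul, sub_mul, smul_mul_assoc, one_mul]
  module

theorem re_trace_mul_eq_zero_of_isHermitian_of_mem_skewAdjoint {K W : Matrix m m 𝕜}
    (hK : K.IsHermitian) (hW : W ∈ skewAdjoint (Matrix m m 𝕜)) :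
    RCLike.re (K * W).trace = 0 := by
  have hstar : (K * W)ᴴ = -(W * K) := by
    rw [Matrix.conjTranspose_mul, hK.eq, ← Matrix.star_eq_conjTranspose, skewAdjoint.mem_iff.1 hW,
      neg_mul]
  have hre := congrArg (fun A => RCLike.re A.trace) hstar
  simp only [Matrix.trace_conjTranspose, Matrix.trace_neg, Matrix.trace_mul_comm W K,
    RCLike.star_def, RCLike.conj_re, map_neg] at hre
  linarith

theorem isHermitian_iff_forall_re_trace_mul_skewAdjoint_eq_zero {K : Matrix m m 𝕜} :
    K.IsHermitian ↔ ∀ W ∈ skewAdjoint (Matrix m m 𝕜), RCLike.re (K * W).trace = 0 := by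
  refine ⟨fun hK W => re_trace_mul_eq_zero_of_isHermitian_of_mem_skewAdjoint hK, fun h => ?_⟩
  have hskew : K - Kᴴ ∈ skewAdjoint (Matrix m m 𝕜) := by
    simp [skewAdjoint.mem_iff, Matrix.star_eq_conjTranspose]
  have hherm : (K + Kᴴ).IsHermitian := Matrix.isHermitian_add_transpose_self K
  have hsq : (K - Kᴴ) * (K - Kᴴ)ᴴ = (K + Kᴴ) * (K - Kᴴ) - (2 : ℕ) • (K * (K - Kᴴ)) := by
    rw [Matrix.conjTranspose_sub, Matrix.conjTranspose_conjTranspose]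
    noncomm_ring
  have hre : RCLike.re ((K - Kᴴ) * (K - Kᴴ)ᴴ).trace = 0 := by
    rw [hsq, Matrix.trace_sub, Matrix.trace_smul, map_sub, map_nsmul, h _ hskew,
      re_trace_mul_eq_zero_of_isHermitian_of_mem_skewAdjoint hherm hskew, smul_zero, sub_zero]
  have htrace : ((K - Kᴴ) * (K - Kᴴ)ᴴ).trace = 0 := by
    have him := (RCLike.nonneg_iff.1
      (Matrix.posSemidef_self_mul_conjTranspose (K - Kᴴ)).trace_nonneg).2
    exact RCLike.ext (by simpa using hre) (by simpa using him)
  exact (sub_eq_zero.1 (Matrix.trace_mul_conjTranspose_self_eq_zero_iff.1 htrace)).symm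

end MatrixLemmas

section Horizontal

variable {n : ℕ}

/-- The differential `dπ_M(A) = M A* + A M*` of the Gram map `π(M) = M M*`. -/
noncomputable def gramDeriv (M : CMat n) : CMat n →L[ℝ] HermMat n :=
  LinearMap.toContinuousLinearMap (E := CMat n) (F' := HermMat n)
    { toFun := fun A => HermMat.mk (M * Aᴴ + A * Mᴴ) (by simp [Matrix.IsHermitian, add_comm])
      map_add' := fun A B => by
        ext1
        change M * (A + B)ᴴ + (A + B) * Mᴴ = M * Aᴴ + A * Mᴴ + (M * Bᴴ + B * Mᴴ)
        rw [Matrix.conjTranspose_add, mul_add, add_mul, add_add_add_comm]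
      map_smul' := fun r A => by
        ext1
        change M * (r • A)ᴴ + (r • A) * Mᴴ = r • (M * Aᴴ + A * Mᴴ)
        simp }

theorem toMat_gramMap (M : CMat n) : (gramMap M : CMat n) = M * Mᴴ := rfl

theorem toMat_gramDeriv (M A : CMat n) : (gramDeriv M A : CMat n) = M * Aᴴ + A * Mᴴ := rfl

theorem toMat_lyapunovMap (S X : HermMat n) : (lyapunovMap n S X : CMat n) = S * X + X * S := rfl

theorem gramMap_add (M A : CMat n) : gramMap (M + A) = gramMap M + gramDeriv M A + gramMap A := by
  ext1
  simp only [map_add, toMat_gramMap, toMat_gramDeriv, Matrix.conjTranspose_add, mul_add, add_mul]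
  abel

theorem gramMap_smul (t : ℝ) (A : CMat n) : gramMap (t • A) = t ^ 2 • gramMap A := by
  ext1
  simp [toMat_gramMap, smul_smul, pow_two]

theorem gramDeriv_add_smul_self (M A : CMat n) (t : ℝ) :
    gramDeriv (M + t • A) A = gramDeriv M A + t • (2 : ℝ) • gramMap A := by
  ext1
  simp only [map_add, map_smul, toMat_gramMap, toMat_gramDeriv, Matrix.conjTranspose_add,
    Matrix.conjTranspose_smul, star_trivial, add_mul, mul_add, smul_mul_assoc, mul_smul_comm]
  module

theorem norm_gramMap_le (A : CMat n) : ‖gramMap A‖ ≤ ‖A‖ ^ 2 :=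
  calc ‖A * Aᴴ‖ ≤ ‖A‖ * ‖Aᴴ‖ := Matrix.frobenius_norm_mul A Aᴴ
    _ = ‖A‖ ^ 2 := by rw [Matrix.frobenius_norm_conjTranspose, pow_two]

theorem hasFDerivAt_gramMap (M : CMat n) : HasFDerivAt gramMap (gramDeriv M) M := by
  have hsq : (gramMap : CMat n → HermMat n) =o[nhds 0] fun A => A :=
    (Asymptotics.isBigO_of_le _ fun A => by simpa using norm_gramMap_le A).trans_isLittleO
      (Asymptotics.isLittleO_norm_pow_id one_lt_two)
  have hincr (A : CMat n) : gramMap (M + A) - gramMap M - gramDeriv M A = gramMap A := by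
    rw [gramMap_add, add_assoc, add_sub_cancel_left, add_sub_cancel_left]
  exact hasFDerivAt_iff_isLittleO_nhds_zero.2 (hsq.congr_left fun A => (hincr A).symm)

theorem mem_verticalSpace_iff {M B : CMat n} :
    B ∈ verticalSpace M ↔ B * Mᴴ ∈ skewAdjoint (CMat n) := by
  rw [verticalSpace, (hasFDerivAt_gramMap M).fderiv, LinearMap.mem_ker, skewAdjoint.mem_iff,
    Matrix.star_eq_conjTranspose, Matrix.conjTranspose_mul, Matrix.conjTranspose_conjTranspose,
    ← add_eq_zero_iff_eq_neg]
  exact (map_eq_zero_iff _ HermMat.toMat_injective).symm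

theorem mem_horizontalSpace_iff_isHermitian_mul_inv {M A : CMat n} (hM : IsUnit M) :
    A ∈ horizontalSpace M ↔ (A * M⁻¹).IsHermitian := by
  have hdet := (Matrix.isUnit_iff_isUnit_det M).1 hM
  have hdet' : IsUnit Mᴴ.det := (Matrix.isUnit_iff_isUnit_det _).1 hM.star
  have htrace : ∀ B ∈ verticalSpace M,
      (A * Bᴴ).trace.re = -RCLike.re (A * M⁻¹ * (B * Mᴴ)).trace := by
    intro B hB
    have hBM : B * Mᴴ = -(M * Bᴴ) := by
      simpa [Matrix.star_eq_conjTranspose, eq_neg_iff_add_eq_zero, add_comm] using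
        skewAdjoint.mem_iff.1 (mem_verticalSpace_iff.1 hB)
    rw [hBM, mul_neg, ← mul_assoc, mul_assoc A, Matrix.nonsing_inv_mul _ hdet, mul_one,
      Matrix.trace_neg, map_neg, neg_neg, RCLike.re_eq_complex_re]
  rw [isHermitian_iff_forall_re_trace_mul_skewAdjoint_eq_zero]
  constructor
  · intro hA W hW
    have hWM : W * (Mᴴ)⁻¹ * Mᴴ = W := by rw [mul_assoc, Matrix.nonsing_inv_mul _ hdet', mul_one]
    have hvert : W * (Mᴴ)⁻¹ ∈ verticalSpace M := mem_verticalSpace_iff.2 (by rwa [hWM])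
    simpa [hWM] using (htrace _ hvert).symm.trans (hA _ hvert)
  · intro hA B hB
    rw [htrace B hB, hA _ (mem_verticalSpace_iff.1 hB), neg_zero]

theorem mul_mem_horizontalSpace {M K : CMat n} (hM : IsUnit M) (hK : K.IsHermitian) :
    K * M ∈ horizontalSpace M := by
  rwa [mem_horizontalSpace_iff_isHermitian_mul_inv hM,
    Matrix.mul_nonsing_inv_cancel_right _ _ ((Matrix.isUnit_iff_isUnit_det M).1 hM)]

theorem mem_horizontalSpace_iff {M A : CMat n} (hM : IsUnit M) :
    A ∈ horizontalSpace M ↔ (Mᴴ * A).IsHermitian :=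
  (mem_horizontalSpace_iff_isHermitian_mul_inv hM).trans (isHermitian_mul_inv_iff hM)

theorem mem_horizontalSpace_add_smul {M A : CMat n} (hM : IsUnit M) (hA : A ∈ horizontalSpace M)
    {t : ℝ} (ht : IsUnit (M + t • A)) : A ∈ horizontalSpace (M + t • A) := by
  rw [mem_horizontalSpace_iff hM] at hA
  rw [mem_horizontalSpace_iff ht, Matrix.conjTranspose_add, Matrix.conjTranspose_smul, star_trivial,
    add_mul, smul_mul_assoc]
  exact hA.add ((Matrix.isHermitian_conjTranspose_mul_self A).smul (.all t))

end Horizontal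

section PolarFactor

variable {n : ℕ}

theorem matSqrt_mul_self {A : CMat n} (hA : A.PosSemidef) : matSqrt A * matSqrt A = A :=
  CFC.sqrt_mul_sqrt_self A hA.nonneg

theorem posDef_matSqrt {A : CMat n} (hA : A.PosDef) : (matSqrt A).PosDef :=
  Matrix.isStrictlyPositive_iff_posDef.1 hA.isStrictlyPositive.sqrt

theorem posDef_mul_conjTranspose_self {M : CMat n} (hM : IsUnit M) : (M * Mᴴ).PosDef :=
  .mul_conjTranspose_self M (Matrix.vecMul_injective_of_isUnit hM)

theorem gramMap_matSqrt {S : HermMat n} (hS : (S : CMat n).PosDef) : gramMap (matSqrt S) = S := by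
  ext1
  rw [toMat_gramMap, (posDef_matSqrt hS).isHermitian.eq, matSqrt_mul_self hS.posSemidef]

theorem gramMap_mul_of_mem_unitaryGroup (M : CMat n) {U : CMat n}
    (hU : U ∈ Matrix.unitaryGroup (Fin n) ℂ) : gramMap (M * U) = gramMap M := by
  ext1
  rw [toMat_gramMap, toMat_gramMap, Matrix.conjTranspose_mul, mul_assoc, ← mul_assoc U,
    ← Matrix.star_eq_conjTranspose U, Matrix.mem_unitaryGroup_iff.1 hU, one_mul]

theorem polarFactor_mem_unitaryGroup {M : CMat n} (hM : IsUnit M) :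
    polarFactor M ∈ Matrix.unitaryGroup (Fin n) ℂ := by
  have hP := posDef_mul_conjTranspose_self hM
  have hR := posDef_matSqrt hP
  have hdet := (Matrix.isUnit_iff_isUnit_det _).1 hR.isUnit
  rw [Matrix.mem_unitaryGroup_iff, Matrix.star_eq_conjTranspose]
  calc polarFactor M * (polarFactor M)ᴴ
      = (matSqrt (M * Mᴴ))⁻¹ * (M * Mᴴ) * (matSqrt (M * Mᴴ))⁻¹ := by
        rw [polarFactor, Matrix.conjTranspose_mul, Matrix.conjTranspose_nonsing_inv,
          hR.isHermitian.eq]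
        simp only [mul_assoc]
    _ = (matSqrt (M * Mᴴ))⁻¹ * (matSqrt (M * Mᴴ) * matSqrt (M * Mᴴ)) * (matSqrt (M * Mᴴ))⁻¹ := by
        rw [matSqrt_mul_self hP.posSemidef]
    _ = 1 := by
        rw [← mul_assoc, Matrix.nonsing_inv_mul _ hdet, one_mul, Matrix.mul_nonsing_inv _ hdet]

/-- The optimal transport matrix `T = B (B A² B)^{-1/2} B` from `A²` to `B²`, for positive definite
`A` and `B`: it is characterised by `T A² T = B²`, and `T A = B U` for the unitary polar factor `U`
of `B A`.  The matrix `B A² B` is written as `(B A) (B A)*`. -/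
noncomputable def transportMatrix (A B : CMat n) : CMat n :=
  B * (matSqrt (B * A * (B * A)ᴴ))⁻¹ * B

theorem transportMatrix_mul (A B : CMat n) :
    transportMatrix A B * A = B * polarFactor (B * A) := by
  simp only [transportMatrix, polarFactor, mul_assoc]

theorem posDef_transportMatrix {A B : CMat n} (hA : IsUnit A) (hB : B.IsHermitian)
    (hB' : IsUnit B) : (transportMatrix A B).PosDef := by
  have hR := (posDef_matSqrt (posDef_mul_conjTranspose_self (hB'.mul hA))).inv
  have hconj := (Matrix.IsUnit.posDef_star_right_conjugate_iff hB').2 hR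
  rwa [Matrix.star_eq_conjTranspose, hB.eq] at hconj

end PolarFactor

section BuresWasserstein

variable {n : ℕ} {S : HermMat n}

theorem bwInner_apply (S H K : HermMat n) :
    bwInner S H K = 1 / 2 * ((lyapunovSol S H : CMat n) * K).trace.re := rfl

theorem bwInner_comm (hS : (S : CMat n).PosDef) (H K : HermMat n) :
    bwInner S H K = bwInner S K H :=
  (bwMetric n).symm S hS H K

theorem lyapunovSol_lyapunovMap (hS : (S : CMat n).PosDef) (X : HermMat n) :
    lyapunovSol S (lyapunovMap n S X) = X :=
  (lyapunovMap_isInvertible hS).inverse_apply_self X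

theorem bwInner_lyapunovMap (hS : (S : CMat n).PosDef) (X K : HermMat n) :
    bwInner S (lyapunovMap n S X) K = 1 / 2 * ((X : CMat n) * K).trace.re := by
  rw [bwInner_apply, lyapunovSol_lyapunovMap hS]

theorem hasFDerivAt_lyapunovSol_apply (hS : (S : CMat n).PosDef) (H : HermMat n) :
    HasFDerivAt (fun S => lyapunovSol S H)
      (-lyapunovSol S ∘L (lyapunovMap n).toContinuousBilinearMap.flip (lyapunovSol S H)) S :=
  hasFDerivAt_inverse_clm_apply (lyapunovMap n).toContinuousBilinearMap.hasFDerivAt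
    (lyapunovMap_isInvertible hS) H

theorem fderiv_bwInner (hS : (S : CMat n).PosDef) (u H K : HermMat n) :
    fderiv ℝ (fun S => bwInner S H K) S u
      = -bwInner S (lyapunovMap n u (lyapunovSol S H)) K := by
  let ℓ : HermMat n →ₗ[ℝ] ℝ := (1 / 2 : ℝ) • (Complex.reLm ∘ₗ
    Matrix.traceLinearMap (Fin n) ℝ ℂ ∘ₗ LinearMap.mulRight ℝ (K : CMat n) ∘ₗ HermMat.toMat)
  have hcomp : HasFDerivAt (fun S => bwInner S H K) _ S :=
    ℓ.toContinuousLinearMap.hasFDerivAt.comp S (hasFDerivAt_lyapunovSol_apply hS H)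
  rw [hcomp.fderiv]
  exact map_neg ℓ _

theorem christoffel_lyapunovMap_self {M : CMat n} (hM : IsUnit M) (X w : HermMat n) :
    (bwMetric n).christoffel (gramMap M) (lyapunovMap n (gramMap M) X)
        (lyapunovMap n (gramMap M) X) w
      = -bwInner (gramMap M) ((2 : ℝ) • gramMap ((X : CMat n) * M)) w := by
  have hS : (gramMap M : CMat n).PosDef := posDef_mul_conjTranspose_self hM
  set S := gramMap M with hSM
  set u := lyapunovMap n S X with hu
  have hsplit : lyapunovMap n u X
      = lyapunovMap n S (gramMap X) + (2 : ℝ) • gramMap ((X : CMat n) * M) := by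
    ext1
    simp only [hu, hSM, toMat_lyapunovMap, toMat_gramMap, map_add, Matrix.conjTranspose_mul,
      X.conjTranspose_eq, two_smul]
    noncomm_ring
  have hgrad : bwInner S (lyapunovMap n w X) u = 2 * bwInner S (lyapunovMap n S (gramMap X)) w := by
    have hcycle : ((X : CMat n) * (w * X)).trace = ((X : CMat n) * (X * w)).trace := by
      rw [Matrix.trace_mul_comm, mul_assoc, Matrix.trace_mul_comm, mul_assoc]
    rw [bwInner_comm hS, bwInner_lyapunovMap hS, bwInner_lyapunovMap hS, toMat_lyapunovMap,
      toMat_gramMap, X.conjTranspose_eq, mul_add, Matrix.trace_add, hcycle, mul_assoc,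
      Complex.add_re]
    ring
  calc (bwMetric n).christoffel S u u w
      = 1 / 2 * (-bwInner S (lyapunovMap n u X) w + -bwInner S (lyapunovMap n u X) w
          - -bwInner S (lyapunovMap n w X) u) := by
        simp only [RiemannianMetricOn.christoffel, bwMetric, fderiv_bwInner hS, hu,
          lyapunovSol_lyapunovMap hS]
    _ = -bwInner S ((2 : ℝ) • gramMap ((X : CMat n) * M)) w := by
        rw [hsplit, map_add, LinearMap.add_apply, hgrad]
        ring

theorem exists_lyapunovMap_eq_gramDeriv {M A : CMat n} (hM : IsUnit M)
    (hA : A ∈ horizontalSpace M) :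
    ∃ X : HermMat n, (X : CMat n) * M = A ∧ lyapunovMap n (gramMap M) X = gramDeriv M A := by
  have hXM : A * M⁻¹ * M = A := by
    rw [mul_assoc, Matrix.nonsing_inv_mul _ ((Matrix.isUnit_iff_isUnit_det M).1 hM), mul_one]
  let X := HermMat.mk (A * M⁻¹) ((mem_horizontalSpace_iff_isHermitian_mul_inv hM).1 hA)
  have hMX : Mᴴ * X = Aᴴ := by
    rw [← X.conjTranspose_eq, ← Matrix.conjTranspose_mul]
    exact congrArg _ hXM
  refine ⟨X, hXM, ?_⟩
  ext1
  rw [toMat_lyapunovMap, toMat_gramMap, toMat_gramDeriv, mul_assoc, hMX, ← mul_assoc]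
  exact congrArg (fun B => M * Aᴴ + B * Mᴴ) hXM

theorem christoffel_gramDeriv_self {M A : CMat n} (hM : IsUnit M) (hA : A ∈ horizontalSpace M)
    (w : HermMat n) :
    (bwMetric n).christoffel (gramMap M) (gramDeriv M A) (gramDeriv M A) w
      = -bwInner (gramMap M) ((2 : ℝ) • gramMap A) w := by
  obtain ⟨X, hXM, hX⟩ := exists_lyapunovMap_eq_gramDeriv hM hA
  rw [← hX, christoffel_lyapunovMap_self hM, hXM]

end BuresWasserstein

section HorizontalLine

variable {n : ℕ}

theorem contDiff_gramMap_add_smul (M A : CMat n) :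
    ContDiff ℝ ∞ fun t : ℝ => gramMap (M + t • A) := by
  simp only [gramMap_add, gramMap_smul, map_smul]
  fun_prop

theorem hasDerivAt_gramMap_add_smul (M A : CMat n) (t : ℝ) :
    HasDerivAt (fun t : ℝ => gramMap (M + t • A)) (gramDeriv (M + t • A) A) t :=
  HasFDerivAt.comp_hasDerivAt (l := gramMap) t (hasFDerivAt_gramMap (M + t • A))
    (hasDerivAt_add_smul M A t)

theorem hasDerivAt_gramDeriv_add_smul_self (M A : CMat n) (t : ℝ) :
    HasDerivAt (fun t : ℝ => gramDeriv (M + t • A) A) ((2 : ℝ) • gramMap A) t := by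
  simp only [gramDeriv_add_smul_self]
  exact hasDerivAt_add_smul _ _ t

theorem isGeodesicOn_gramMap_add_smul {M A : CMat n} {I : Set ℝ} (hI : UniqueDiffOn ℝ I)
    (hM : IsUnit M) (hA : A ∈ horizontalSpace M) (hunit : ∀ t ∈ I, IsUnit (M + t • A)) :
    (bwMetric n).IsGeodesicOn (fun t => gramMap (M + t • A)) I where
  smooth := (contDiff_gramMap_add_smul M A).contDiffOn
  mem t ht := posDef_mul_conjTranspose_self (hunit t ht)
  equation t ht w := by
    have hvel : ∀ s ∈ I, derivWithin (fun t : ℝ => gramMap (M + t • A)) I s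
        = gramDeriv (M + s • A) A := fun s hs =>
      (hasDerivAt_gramMap_add_smul M A s).hasDerivWithinAt.derivWithin (hI s hs)
    have hacc : derivWithin (derivWithin (fun t : ℝ => gramMap (M + t • A)) I) I t
        = (2 : ℝ) • gramMap A := by
      rw [derivWithin_congr hvel (hvel t ht)]
      exact (hasDerivAt_gramDeriv_add_smul_self M A t).hasDerivWithinAt.derivWithin (hI t ht)
    rw [hacc, hvel t ht, christoffel_gramDeriv_self (hunit t ht)
      (mem_horizontalSpace_add_smul hM hA (hunit t ht))]
    exact add_neg_cancel _

end HorizontalLine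

theorem theorem2p9 (n : ℕ) (S₁ S₂ : HermMat n) (h₁ : S₁ ∈ posDefOpens n)
    (h₂ : S₂ ∈ posDefOpens n) (U : CMat n) (hU : U = polarFactor (matSqrt S₂ * matSqrt S₁))
    (γ : ℝ → CMat n)
    (hγ : ∀ t : ℝ, γ t = (1 - t) • matSqrt (S₁ : CMat n) + t • (matSqrt (S₂ : CMat n) * U)) :
    (∀ t ∈ Icc (0 : ℝ) 1, IsUnit (γ t)) ∧
    deriv γ 0 ∈ horizontalSpace (γ 0) ∧
    (bwMetric n).IsGeodesicFromTo (fun t => gramMap (γ t)) S₁ S₂ := by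
  have hA := posDef_matSqrt h₁
  have hB := posDef_matSqrt h₂
  set A := matSqrt (S₁ : CMat n)
  set B := matSqrt (S₂ : CMat n)
  set T := transportMatrix A B
  have hT : T.PosDef := posDef_transportMatrix hA.isUnit hB.isHermitian hB.isUnit
  have hhor : (T - 1) * A ∈ horizontalSpace A :=
    mul_mem_horizontalSpace hA.isUnit (hT.isHermitian.sub Matrix.isHermitian_one)
  have hline : γ = fun t => A + t • ((T - 1) * A) := by
    funext t
    rw [hγ, hU, ← transportMatrix_mul, sub_mul, one_mul]
    module
  have hunit : ∀ t ∈ Icc (0 : ℝ) 1, IsUnit (A + t • ((T - 1) * A)) := fun t =>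
    isUnit_add_smul_sub_one_mul hA.isUnit hT
  have hderiv : deriv γ 0 = (T - 1) * A := hline ▸ (hasDerivAt_add_smul A _ (0 : ℝ)).deriv
  have hzero : γ 0 = A := by simp [hγ]
  have hone : gramMap (γ 1) = gramMap B := by
    simpa [hγ, hU] using
      gramMap_mul_of_mem_unitaryGroup B (polarFactor_mem_unitaryGroup (hB.isUnit.mul hA.isUnit))
  refine ⟨hline ▸ hunit, by rwa [hderiv, hzero], hline ▸ ?_,
    (congrArg gramMap hzero).trans (gramMap_matSqrt h₁), hone.trans (gramMap_matSqrt h₂)⟩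
  exact isGeodesicOn_gramMap_add_smul (uniqueDiffOn_Icc zero_lt_one) hA.isUnit hhor hunit
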